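/- Let $c\in\mathbb C$ and $f(z)=z^2+c$, let $K=\{z\in\mathbb C : (f^{\circ n}(z))_{n\ge 0}\text{ is bounded}\}$ be its filled Julia set and $J=\partial K$ its Julia set. Assume that $K$ is connected and locally connected. Let $\psi:\{w\in\mathbb C: |w|>1\}\to\mathbb C\smallsetminus K$ be the unique conformal isomorphism with $\psi(w)/w\to 1$ as $w\to\infty$ and $\psi(w^2)=f(\psi(w))$. For $t\in\mathbb R/\mathbb Z$ let $\gamma(t)=\lim_{r\downarrow 1}\psi(re^{2\pi i t})$, and let the Brolin measure $\mu=\gamma_*\ell$ be the push-forward by $\gamma$ of the normalized Lebesgue measure $\ell$ on $\mathbb R/\mathbb Z$. Let $A\subset J$ be forward-invariant under $f$, i.e. $f(A)\subset A$. Then $\mu(A)=0$ or $\mu(A)=1$. In particular, if $A$ is compact and $A\ne J$, then $\mu(A)=0$. (If $A$ is not $\mu$-measurable, $\mu(A)$ denotes the outer measure.) -/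

import Mathlib

namespace QuadraticDynamics

/-- The quadratic polynomial `z ↦ z ^ 2 + c`. -/
def quadMap (c : ℂ) (z : ℂ) : ℂ := z ^ 2 + c

/-- The filled Julia set: the points whose forward orbit is bounded. -/
def filledJulia (c : ℂ) : Set ℂ :=
  {z | Bornology.IsBounded (Set.range fun n : ℕ => (quadMap c)^[n] z)}

/-- The Julia set: the boundary of the filled Julia set. -/
def julia (c : ℂ) : Set ℂ := frontier (filledJulia c)

/-- `ψ` is the inverse Böttcher coordinate: a conformal isomorphism from the exterior of the closed
unit disk onto the complement of the filled Julia set, with `ψ(∞) = ∞` and `ψ'(∞) = 1`, which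
conjugates the squaring map to the quadratic polynomial. The values of `ψ` on the closed unit disk
play no role. If the filled Julia set is connected, then such a `ψ` exists and is unique on the
exterior of the closed disk. -/
structure IsInverseBottcher (c : ℂ) (ψ : ℂ → ℂ) : Prop where
  differentiableOn : DifferentiableOn ℂ ψ {w : ℂ | 1 < ‖w‖}
  bijOn : Set.BijOn ψ {w : ℂ | 1 < ‖w‖} (filledJulia c)ᶜ
  tendsto_div : Filter.Tendsto (fun w : ℂ => ψ w / w) (Bornology.cobounded ℂ) (nhds 1)
  semiconj : ∀ w : ℂ, 1 < ‖w‖ → ψ (w ^ 2) = quadMap c (ψ w)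

/-- The radial limit `lim_{r ↓ 1} ψ (r * exp (2 π i t))` at the angle `t ∈ ℝ / ℤ`. If `ψ` is the
inverse Böttcher coordinate of a locally connected filled Julia set, this is the Carathéodory
loop. -/
noncomputable def radialLimit (ψ : ℂ → ℂ) (t : UnitAddCircle) : ℂ :=
  Filter.limUnder (nhdsWithin (1 : ℝ) (Set.Ioi 1)) fun r : ℝ => ψ ((r : ℂ) * (AddCircle.toCircle t : ℂ))

open Classical in
/-- The Brolin measure: the push-forward of Lebesgue measure on `ℝ / ℤ` by the radial limits of the
inverse Böttcher coordinate `ψ`. The second branch is a default value which does not occur for a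
connected filled Julia set. -/
noncomputable def brolinMeasure (c : ℂ) : MeasureTheory.Measure ℂ :=
  if h : ∃ ψ : ℂ → ℂ, IsInverseBottcher c ψ then
    (MeasureTheory.volume : MeasureTheory.Measure UnitAddCircle).map (radialLimit h.choose)
  else 0

end QuadraticDynamics

open MeasureTheory Filter Topology Metric
open scoped ComplexConjugate

namespace QuadraticDynamics

/-! The radial limit map `γ` satisfies `γ (2t) = f (γ t)` almost everywhere, so `μ` is a factor of
the ergodic doubling map. A measurable hull `B` of `A` satisfies `B ⊆ f⁻¹ B` up to a null set,
because `B ∩ f⁻¹ B` also contains `A`. Hence `γ⁻¹ B` is almost invariant under doubling, and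
ergodicity gives measure 0 or 1 (`map_measure_eq_zero_or_one_of_image_subset`).

For compact `A` it remains to see that every point `z₀` of `J` lies in the support of `μ`
(`not_ae_le_norm_radialLimit_sub`). If almost all radial limits had distance at least `δ` from `z₀`,
take `z = ψ w₀` very near `z₀` and divide by `ψ (1/u) - z` the Blaschke factor vanishing at `1/w₀`.
This quotient is bounded on the disk, with boundary values at most `2/δ`, yet it exceeds `2/δ` at a
suitable point: a contradiction.

Only almost everywhere radial limits are used. They exist by a length-area argument
(`ae_exists_radial_limit`). -/

/-! ### Maximum principle for radial boundary values -/

theorem circleAverage_eq_integral_unitAddCircle (F : ℂ → ℂ) (r : ℝ) :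
    Real.circleAverage F 0 r =
      ∫ t : UnitAddCircle, F ((r : ℂ) * (AddCircle.toCircle t : ℂ)) := by
  rw [← UnitAddCircle.intervalIntegral_preimage 0, Real.circleAverage_def]
  have h := intervalIntegral.integral_comp_mul_left (a := 0) (b := 1)
    (fun θ : ℝ => F (circleMap 0 r θ)) (c := 2 * Real.pi) (by positivity)
  simp only [mul_zero, mul_one] at h
  rw [← h, zero_add]
  refine intervalIntegral.integral_congr fun x _ => ?_
  simp [circleMap, AddCircle.toCircle_apply_mk]

/-- A weak form of the maximum principle for almost everywhere radial boundary values. -/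
theorem norm_le_div_of_ae_radial_norm_le {H : ℂ → ℂ} {C M : ℝ} {u : ℂ}
    (hd : DifferentiableOn ℂ H (ball 0 1)) (hC : ∀ z ∈ ball (0 : ℂ) 1, ‖H z‖ ≤ C)
    (hM : ∀ᵐ t : UnitAddCircle, ∃ a : ℂ, ‖a‖ ≤ M ∧
      Tendsto (fun r : ℝ => H ((r : ℂ) * (AddCircle.toCircle t : ℂ))) (𝓝[<] 1) (𝓝 a))
    (hu : ‖u‖ < 1) : ‖H u‖ ≤ M / (1 - ‖u‖) := by
  have hC0 : 0 ≤ C := (norm_nonneg _).trans (hC 0 (by simp))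
  classical
  let a : UnitAddCircle → ℂ := fun t =>
    if h : ∃ a : ℂ, ‖a‖ ≤ M ∧
      Tendsto (fun r : ℝ => H ((r : ℂ) * (AddCircle.toCircle t : ℂ))) (𝓝[<] 1) (𝓝 a)
    then h.choose else 0
  have ha : ∀ᵐ t : UnitAddCircle, ‖a t‖ ≤ M ∧
      Tendsto (fun r : ℝ => H ((r : ℂ) * (AddCircle.toCircle t : ℂ))) (𝓝[<] 1) (𝓝 (a t)) := by
    filter_upwards [hM] with t ht
    simp only [a, dif_pos ht]
    exact ht.choose_spec
  -- The Cauchy kernel with respect to normalized arc length; on the unit circle its modulus is at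
  -- most `1 / (1 - ‖u‖)`.
  let k : ℂ → ℂ := fun z => z / (z - u)
  have hr : ∀ᶠ r : ℝ in 𝓝[<] 1, (1 + ‖u‖) / 2 < r ∧ r < 1 := by
    filter_upwards [Ioo_mem_nhdsLT (show (1 + ‖u‖) / 2 < 1 by linarith)] with r hr using hr
  have hnorm : ∀ {r : ℝ} (t : UnitAddCircle), 0 < r →
      ‖(r : ℂ) * (AddCircle.toCircle t : ℂ)‖ = r := fun t h => by
    rw [norm_mul, Circle.norm_coe, mul_one, Complex.norm_of_nonneg h.le]
  have hmean : ∀ᶠ r : ℝ in 𝓝[<] 1, ∫ t : UnitAddCircle,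
      k ((r : ℂ) * (AddCircle.toCircle t : ℂ)) * H ((r : ℂ) * (AddCircle.toCircle t : ℂ)) =
        H u := by
    filter_upwards [hr] with r hr
    have hr0 : 0 < r := by linarith [norm_nonneg u]
    rw [← circleAverage_eq_integral_unitAddCircle (fun z => k z * H z)]
    have hdc : DiffContOnCl ℂ H (ball 0 |r|) := by
      apply DifferentiableOn.diffContOnCl
      refine hd.mono ?_
      rw [abs_of_pos hr0, closure_ball _ hr0.ne']
      exact closedBall_subset_ball hr.2
    have := DiffContOnCl.circleAverage_smul_div hdc (w := u)
      (by simp only [mem_ball_zero_iff, abs_of_pos hr0]; linarith)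
    simpa [k] using this
  have hlim : Tendsto (fun r : ℝ => ∫ t : UnitAddCircle,
      k ((r : ℂ) * (AddCircle.toCircle t : ℂ)) * H ((r : ℂ) * (AddCircle.toCircle t : ℂ)))
      (𝓝[<] 1) (𝓝 (∫ t : UnitAddCircle, k (AddCircle.toCircle t : ℂ) * a t)) := by
    refine tendsto_integral_filter_of_dominated_convergence
      (fun _ => 1 / ((1 - ‖u‖) / 2) * C) ?_ ?_ (integrable_const _) ?_
    · filter_upwards [hr] with r hr
      have hr0 : 0 < r := by linarith [norm_nonneg u]
      refine Continuous.aestronglyMeasurable ?_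
      have hc : Continuous fun t : UnitAddCircle => (r : ℂ) * (AddCircle.toCircle t : ℂ) :=
        continuous_const.mul (continuous_subtype_val.comp AddCircle.continuous_toCircle)
      refine (hc.div (hc.sub continuous_const) fun t h => ?_).mul
        (hd.continuousOn.comp_continuous hc fun t => ?_)
      · have := congrArg norm (sub_eq_zero.1 h)
        rw [hnorm t hr0] at this
        linarith
      · rw [mem_ball_zero_iff, hnorm t hr0]; exact hr.2
    · filter_upwards [hr] with r hr
      have hr0 : 0 < r := by linarith [norm_nonneg u]
      refine ae_of_all _ fun t => ?_
      rw [norm_mul]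
      refine mul_le_mul ?_ (hC _ ?_) (norm_nonneg _) ?_
      · rw [norm_div, hnorm t hr0]
        have h1 := norm_sub_norm_le ((r : ℂ) * (AddCircle.toCircle t : ℂ)) u
        rw [hnorm t hr0] at h1
        exact div_le_div₀ zero_le_one hr.2.le (by linarith) (by linarith)
      · rw [mem_ball_zero_iff, hnorm t hr0]; exact hr.2
      · exact div_nonneg zero_le_one (by linarith)
    · filter_upwards [ha] with t ht
      refine Tendsto.mul ?_ ht.2
      have h1 : Tendsto (fun r : ℝ => (r : ℂ) * (AddCircle.toCircle t : ℂ)) (𝓝[<] 1)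
          (𝓝 (AddCircle.toCircle t : ℂ)) := by
        have : Continuous fun r : ℝ => (r : ℂ) * (AddCircle.toCircle t : ℂ) := by fun_prop
        simpa using (this.tendsto 1).mono_left nhdsWithin_le_nhds
      refine h1.div (h1.sub_const u) fun h => ?_
      have := congrArg norm (sub_eq_zero.1 h)
      rw [Circle.norm_coe] at this
      linarith
  have hH : H u = ∫ t : UnitAddCircle, k (AddCircle.toCircle t : ℂ) * a t :=
    tendsto_nhds_unique (tendsto_const_nhds.congr' (hmean.mono fun _ h => h.symm)) hlim
  rw [hH]
  have hb := norm_integral_le_of_norm_le_const (μ := (volume : Measure UnitAddCircle))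
    (f := fun t => k (AddCircle.toCircle t : ℂ) * a t) (C := M / (1 - ‖u‖)) (by
      filter_upwards [ha] with t ht
      rw [norm_mul, norm_div, Circle.norm_coe]
      have h1 := norm_sub_norm_le (AddCircle.toCircle t : ℂ) u
      rw [Circle.norm_coe] at h1
      rw [div_eq_mul_inv, one_mul, div_eq_inv_mul]
      exact mul_le_mul (inv_anti₀ (by linarith) h1) ht.1 (norm_nonneg _)
        (inv_nonneg.2 (by linarith)))
  simpa [measureReal_def, UnitAddCircle.measure_univ] using hb

/-- The maximum principle for bounded holomorphic functions on the unit disk whose radial boundary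
values are bounded almost everywhere. -/
theorem norm_le_of_ae_radial_norm_le {H : ℂ → ℂ} {C M : ℝ} {u : ℂ}
    (hd : DifferentiableOn ℂ H (ball 0 1)) (hC : ∀ z ∈ ball (0 : ℂ) 1, ‖H z‖ ≤ C)
    (hM : ∀ᵐ t : UnitAddCircle, ∃ a : ℂ, ‖a‖ ≤ M ∧
      Tendsto (fun r : ℝ => H ((r : ℂ) * (AddCircle.toCircle t : ℂ))) (𝓝[<] 1) (𝓝 a))
    (hu : ‖u‖ < 1) : ‖H u‖ ≤ M := by
  have hM0 : 0 ≤ M := by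
    obtain ⟨t, a, ha, -⟩ := hM.exists
    exact (norm_nonneg a).trans ha
  -- Power trick: the factor `1 / (1 - ‖u‖)` does not depend on `n`, so it cannot compensate for `‖H
  -- u‖ > M` as `n` grows.
  have hpow : ∀ n : ℕ, ‖H u‖ ^ n ≤ M ^ n / (1 - ‖u‖) := fun n => by
    rw [← norm_pow]
    refine norm_le_div_of_ae_radial_norm_le (H := fun z => H z ^ n) (C := C ^ n) (hd.pow n)
      (fun z hz => ?_) ?_ hu
    · rw [norm_pow]
      exact pow_le_pow_left₀ (norm_nonneg _) (hC z hz) n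
    · filter_upwards [hM] with t ⟨a, ha, hta⟩
      refine ⟨a ^ n, ?_, hta.pow n⟩
      rw [norm_pow]
      exact pow_le_pow_left₀ (norm_nonneg _) ha n
  by_contra! h
  have hx : 0 < ‖H u‖ := hM0.trans_lt h
  obtain ⟨n, hn⟩ := exists_pow_lt_of_lt_one (show 0 < 1 - ‖u‖ by linarith)
    ((div_lt_one hx).2 h)
  have h1 := hpow n
  rw [div_pow, div_lt_iff₀ (by positivity)] at hn
  rw [le_div_iff₀ (by linarith)] at h1
  linarith

/-! ### Almost everywhere existence of radial limits -/

/-- On a bounded interval a square-integrable derivative is integrable, and the fundamental theorem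
of calculus then gives the limit at the endpoint. -/
theorem exists_tendsto_of_lintegral_deriv_sq_lt_top {h h' : ℝ → ℂ} (hm : Measurable h')
    (hd : ∀ s ∈ Set.Ioo (0 : ℝ) 1, HasDerivAt h (h' s) s)
    (hint : ∫⁻ s in Set.Ioo (0 : ℝ) 1, ENNReal.ofReal (‖h' s‖ ^ 2) < ⊤) :
    ∃ L, Tendsto h (𝓝[>] 0) (𝓝 L) := by
  have hi2 : IntegrableOn (fun s => ‖h' s‖ ^ 2) (Set.Ioo (0 : ℝ) 1) := by
    refine ⟨(hm.norm.pow_const 2).aestronglyMeasurable, ?_⟩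
    rw [hasFiniteIntegral_iff_ofReal (ae_of_all _ fun s => by positivity)]
    exact hint
  have hi : IntegrableOn h' (Set.Ioo (0 : ℝ) 1) := by
    refine Integrable.mono' ((integrable_const (1 : ℝ)).add hi2) hm.aestronglyMeasurable
      (ae_of_all _ fun s => ?_)
    simp only [Pi.add_apply]
    nlinarith [sq_nonneg (‖h' s‖ - 1), norm_nonneg (h' s)]
  have hc : ContinuousOn (fun x => ∫ s in x..(1 / 2 : ℝ), h' s) (Set.uIcc 0 (1 / 2)) := by
    refine intervalIntegral.continuousOn_primitive_interval_left ?_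
    rw [Set.uIcc_of_le (by norm_num), integrableOn_Icc_iff_integrableOn_Ioc]
    exact hi.mono_set fun x hx => ⟨hx.1, hx.2.trans_lt (by norm_num)⟩
  have h0 : Tendsto (fun x => ∫ s in x..(1 / 2 : ℝ), h' s) (𝓝[>] 0)
      (𝓝 (∫ s in (0 : ℝ)..(1 / 2 : ℝ), h' s)) := by
    have h1 := hc 0 Set.left_mem_uIcc
    rw [Set.uIcc_of_le (by norm_num)] at h1
    refine h1.tendsto.mono_left ?_
    rw [nhdsWithin_Icc_eq_nhdsGE (by norm_num)]
    exact nhdsWithin_mono _ Set.Ioi_subset_Ici_self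
  refine ⟨h (1 / 2) - ∫ s in (0 : ℝ)..(1 / 2 : ℝ), h' s, (h0.const_sub (h (1 / 2))).congr' ?_⟩
  filter_upwards [Ioo_mem_nhdsGT (show (0 : ℝ) < 1 / 2 by norm_num)] with x hx
  have hsub : Set.uIcc x (1 / 2) ⊆ Set.Ioo 0 1 := by
    rw [Set.uIcc_of_le hx.2.le]
    exact fun y hy => ⟨hx.1.trans_le hy.1, hy.2.trans_lt (by norm_num)⟩
  rw [intervalIntegral.integral_eq_sub_of_hasDerivAt (fun s hs => hd s (hsub hs))]
  · ring
  · rw [intervalIntegrable_iff]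
    exact hi.mono_set (Set.uIoc_subset_uIcc.trans hsub)

/-- The determinant is the field norm of `ℂ` over `ℝ`. This supplies the Jacobian of a holomorphic
map in the area formula. -/
theorem abs_det_smul_one (a : ℂ) : |(a • (1 : ℂ →L[ℝ] ℂ)).det| = ‖a‖ ^ 2 := by
  have h : ((a • (1 : ℂ →L[ℝ] ℂ) : ℂ →L[ℝ] ℂ) : ℂ →ₗ[ℝ] ℂ) = Algebra.lmul ℝ ℂ a := by
    ext
    simp
  rw [ContinuousLinearMap.det, h, ← Complex.normSq_eq_norm_sq, Algebra.coe_lmul_eq_mul,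
    ← LinearMap.toFun_eq_coe]
  change |Algebra.norm ℝ a| = _
  rw [Algebra.norm_complex_apply]
  exact abs_of_nonneg (Complex.normSq_nonneg a)

/-- A univalent function on a rectangle whose image has finite area has limits along almost every
horizontal line. -/
theorem ae_exists_tendsto_of_injOn_rectangle {g : ℂ → ℂ} {a b : ℝ}
    (hd : DifferentiableOn ℂ g (Set.Ioo 0 1 ×ℂ Set.Ioo a b))
    (hinj : Set.InjOn g (Set.Ioo 0 1 ×ℂ Set.Ioo a b))
    (hfin : volume (g '' (Set.Ioo 0 1 ×ℂ Set.Ioo a b)) < ⊤) :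
    ∀ᵐ t : ℝ, t ∈ Set.Ioo a b →
      ∃ L, Tendsto (fun s : ℝ => g (s + t * Complex.I)) (𝓝[>] 0) (𝓝 L) := by
  have hopen : IsOpen (Set.Ioo 0 1 ×ℂ Set.Ioo a b) := isOpen_Ioo.reProdIm isOpen_Ioo
  have hderiv : ∀ z ∈ Set.Ioo 0 1 ×ℂ Set.Ioo a b, HasDerivAt g (deriv g z) z := fun z hz =>
    (hd.differentiableAt (hopen.mem_nhds hz)).hasDerivAt
  -- By injectivity the integral of `‖g'‖ ^ 2` is the area of the image; Fubini makes it finite on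
  -- almost every horizontal line.
  have harea := lintegral_image_eq_lintegral_abs_det_fderiv_mul volume hopen.measurableSet
    (fun z hz => (hderiv z hz).complexToReal_fderiv.hasFDerivWithinAt) hinj (fun _ => 1)
  simp only [lintegral_const, abs_det_smul_one, mul_one, one_mul,
    Measure.restrict_apply MeasurableSet.univ, Set.univ_inter] at harea
  have hmeas : Measurable fun z : ℂ => ENNReal.ofReal (‖deriv g z‖ ^ 2) :=
    ((measurable_deriv g).norm.pow_const 2).ennreal_ofReal
  have hpre : Set.Ioo 0 1 ×ℂ Set.Ioo a b =
      Complex.measurableEquivRealProd ⁻¹' (Set.Ioo (0 : ℝ) 1 ×ˢ Set.Ioo a b) := by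
    ext z; simp [Complex.mem_reProdIm]
  have hprod : ∫⁻ z in Set.Ioo 0 1 ×ℂ Set.Ioo a b, ENNReal.ofReal (‖deriv g z‖ ^ 2) =
      ∫⁻ p in Set.Ioo (0 : ℝ) 1 ×ˢ Set.Ioo a b,
        ENNReal.ofReal (‖deriv g (Complex.measurableEquivRealProd.symm p)‖ ^ 2) := by
    rw [hpre, ← Complex.volume_preserving_equiv_real_prod.setLIntegral_comp_preimage_emb
      Complex.measurableEquivRealProd.measurableEmbedding]
    simp
  have hm2 : Measurable fun p : ℝ × ℝ =>
      ENNReal.ofReal (‖deriv g (Complex.measurableEquivRealProd.symm p)‖ ^ 2) :=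
    hmeas.comp Complex.measurableEquivRealProd.symm.measurable
  rw [hprod, Measure.volume_eq_prod, ← Measure.prod_restrict,
    lintegral_prod_symm _ hm2.aemeasurable] at harea
  have hae := ae_lt_top (hm2.lintegral_prod_left' (μ := volume.restrict (Set.Ioo (0 : ℝ) 1)))
    (harea ▸ hfin).ne
  rw [ae_restrict_iff' measurableSet_Ioo] at hae
  filter_upwards [hae] with t ht htab
  have hform : ∀ s : ℝ, Complex.measurableEquivRealProd.symm (s, t) = s + t * Complex.I :=
    fun s => by simp [Complex.ext_iff]
  simp only [hform] at ht
  refine exists_tendsto_of_lintegral_deriv_sq_lt_top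
    (h' := fun s : ℝ => deriv g (s + t * Complex.I)) ?_ (fun s hs => ?_) (ht htab)
  · exact (measurable_deriv g).comp (by fun_prop)
  · have h1 := hderiv (s + t * Complex.I) (by simpa [Complex.mem_reProdIm] using ⟨hs, htab⟩)
    have h2 : HasDerivAt (fun z : ℂ => z + t * Complex.I) 1 (s : ℂ) :=
      (hasDerivAt_id _).add_const _
    simpa using (h1.comp (s : ℂ) h2).comp_ofReal

/-- A bounded univalent function on the annulus `1 < ‖w‖ < exp (2 * π)` has radial limits almost
everywhere on the unit circle. -/
theorem ae_exists_radial_limit {ψ : ℂ → ℂ} (hd : DifferentiableOn ℂ ψ {w : ℂ | 1 < ‖w‖})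
    (hinj : Set.InjOn ψ {w : ℂ | 1 < ‖w‖})
    (hb : Bornology.IsBounded (ψ '' {w : ℂ | 1 < ‖w‖ ∧ ‖w‖ < Real.exp (2 * Real.pi)})) :
    ∀ᵐ t : UnitAddCircle, ∃ L,
      Tendsto (fun r : ℝ => ψ ((r : ℂ) * (AddCircle.toCircle t : ℂ))) (𝓝[>] 1) (𝓝 L) := by
  have hpi := Real.pi_pos
  -- Under `ζ ↦ exp (2πζ)` the horizontal line at height `t` becomes the ray of angle `t`. Heights
  -- in `(-1/2, 1/2)` keep the argument in `(-π, π)`, where `exp` is injective.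
  set R : Set ℂ := Set.Ioo 0 1 ×ℂ Set.Ioo (-1 / 2) (1 / 2)
  let e : ℂ → ℂ := fun ζ => Complex.exp (2 * Real.pi * ζ)
  have hnorm : ∀ ζ, ‖e ζ‖ = Real.exp (2 * Real.pi * ζ.re) := fun ζ => by
    simp [e, Complex.norm_exp]
  have hmaps : Set.MapsTo e R {w : ℂ | 1 < ‖w‖} := fun ζ hζ => by
    rw [Set.mem_ofPred_eq, hnorm, Real.one_lt_exp_iff]
    have := hζ.1.1
    positivity
  have himage : e '' R ⊆ {w : ℂ | 1 < ‖w‖ ∧ ‖w‖ < Real.exp (2 * Real.pi)} := by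
    rintro _ ⟨ζ, hζ, rfl⟩
    refine ⟨hmaps hζ, ?_⟩
    rw [hnorm, Real.exp_lt_exp]
    have := hζ.1.2
    nlinarith
  have heinj : Set.InjOn e R := fun x hx y hy hxy => by
    have him : ∀ z : ℂ, ((2 * Real.pi : ℂ) * z).im = 2 * Real.pi * z.im := fun z => by
      simp
    have hx1 := hx.2.1
    have hx2 := hx.2.2
    have hy1 := hy.2.1
    have hy2 := hy.2.2
    have := Complex.exp_inj_of_neg_pi_lt_of_le_pi (by rw [him]; nlinarith) (by rw [him]; nlinarith)
      (by rw [him]; nlinarith) (by rw [him]; nlinarith) hxy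
    exact mul_left_cancel₀ (by simp [hpi.ne']) this
  have hlim := ae_exists_tendsto_of_injOn_rectangle (g := ψ ∘ e) (a := -1 / 2) (b := 1 / 2)
    (hd.comp (by fun_prop) hmaps) (hinj.comp heinj hmaps) (by
      rw [Set.image_comp]
      exact (hb.subset (Set.image_mono himage)).measure_lt_top)
  have hsub : ∀ᵐ x : Set.Ioc (-1 / 2 : ℝ) (-1 / 2 + 1) ∂Measure.comap Subtype.val volume, ∃ L,
      Tendsto (fun s : ℝ => (ψ ∘ e) (s + (x : ℝ) * Complex.I)) (𝓝[>] 0) (𝓝 L) := by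
    have h1 : ∀ᵐ t : ℝ, t ≠ 1 / 2 := by simp [ae_iff]
    have h2 : ∀ᵐ t : ℝ ∂volume.restrict (Set.Ioc (-1 / 2 : ℝ) (-1 / 2 + 1)), ∃ L,
        Tendsto (fun s : ℝ => (ψ ∘ e) (s + t * Complex.I)) (𝓝[>] 0) (𝓝 L) := by
      rw [ae_restrict_iff' measurableSet_Ioc]
      filter_upwards [hlim, h1] with t ht htne hmem
      exact ht ⟨hmem.1, lt_of_le_of_ne (by linarith [hmem.2]) htne⟩
    rw [← map_comap_subtype_coe measurableSet_Ioc] at h2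
    exact ae_of_ae_map measurable_subtype_coe.aemeasurable h2
  have hcirc := (AddCircle.measurePreserving_equivIoc (1 : ℝ)
    (a := (-1 / 2 : ℝ))).quasiMeasurePreserving.ae hsub
  filter_upwards [hcirc] with t ⟨L, hL⟩
  refine ⟨L, ?_⟩
  have hlog : Tendsto (fun r : ℝ => Real.log r / (2 * Real.pi)) (𝓝[>] 1) (𝓝[>] 0) := by
    refine tendsto_nhdsWithin_iff.2 ⟨?_, ?_⟩
    · have := ((Real.continuousAt_log one_ne_zero).div_const (2 * Real.pi)).tendsto
      rw [Real.log_one, zero_div] at this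
      exact this.mono_left nhdsWithin_le_nhds
    · filter_upwards [self_mem_nhdsWithin] with r hr
      exact div_pos (Real.log_pos hr) (by positivity)
  refine (hL.comp hlog).congr' ?_
  filter_upwards [self_mem_nhdsWithin] with r hr
  have hr0 : (0 : ℝ) < r := zero_lt_one.trans hr
  have ht : (AddCircle.toCircle t : ℂ) =
      Complex.exp (2 * Real.pi * (AddCircle.equivIoc (1 : ℝ) (-1 / 2) t : ℝ) * Complex.I) := by
    conv_lhs => rw [← AddCircle.coe_equivIoc (p := (1 : ℝ)) (a := (-1 / 2 : ℝ)) (y := t)]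
    rw [AddCircle.toCircle_apply_mk]
    simp [Circle.coe_exp]
  simp only [Function.comp_apply, e, ht]
  congr 1
  rw [mul_add, Complex.exp_add, ← mul_assoc]
  congr 1
  rw [Complex.ofReal_div, Complex.ofReal_mul, Complex.ofReal_ofNat, mul_div_cancel₀,
    ← Complex.ofReal_exp, Real.exp_log hr0]
  simp [hpi.ne']

/-! ### Basic properties of the inverse Böttcher coordinate -/

theorem isOpen_one_lt_norm : IsOpen {w : ℂ | 1 < ‖w‖} :=
  isOpen_lt continuous_const continuous_norm

namespace IsInverseBottcher

variable {c : ℂ} {ψ : ℂ → ℂ}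

theorem analyticAt (hψ : IsInverseBottcher c ψ) {w : ℂ} (hw : 1 < ‖w‖) : AnalyticAt ℂ ψ w :=
  hψ.differentiableOn.analyticAt (isOpen_one_lt_norm.mem_nhds hw)

theorem exists_norm_bounds (hψ : IsInverseBottcher c ψ) :
    ∃ R : ℝ, ∀ w : ℂ, R ≤ ‖w‖ → ‖w‖ / 2 ≤ ‖ψ w‖ ∧ ‖ψ w‖ ≤ 2 * ‖w‖ := by
  have h := hψ.tendsto_div.eventually (ball_mem_nhds 1 (show (0 : ℝ) < 1 / 2 by norm_num))
  obtain ⟨R, -, hR⟩ := (hasBasis_cobounded_norm (E := ℂ)).eventually_iff.1 h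
  refine ⟨max R 1, fun w hw => ?_⟩
  have h1 : dist (ψ w / w) 1 < 1 / 2 := hR ((le_max_left _ _).trans hw)
  have hw0 : 0 < ‖w‖ := zero_lt_one.trans_le ((le_max_right _ _).trans hw)
  rw [dist_eq_norm] at h1
  have h2 : ‖ψ w / w‖ * ‖w‖ = ‖ψ w‖ := by rw [norm_div, div_mul_cancel₀ _ hw0.ne']
  have h3 := norm_sub_norm_le (ψ w / w) 1
  have h4 := norm_sub_norm_le 1 (ψ w / w)
  rw [norm_sub_rev] at h4
  rw [norm_one] at h3 h4
  rw [← h2]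
  constructor <;> nlinarith

/-- The inverse Böttcher coordinate grows at most linearly, uniformly up to the unit circle. -/
theorem norm_le (hψ : IsInverseBottcher c ψ) {w : ℂ} (hw : 1 < ‖w‖) :
    ‖ψ w‖ ≤ (2 + ‖c‖) * ‖w‖ := by
  obtain ⟨R, hR⟩ := hψ.exists_norm_bounds
  -- Induction on the number of squarings needed to reach `‖w‖ ≥ R`; the functional equation pulls
  -- the bound back from `w ^ 2` to `w`.
  have key : ∀ n : ℕ, ∀ w : ℂ, 1 < ‖w‖ → R ≤ ‖w‖ ^ 2 ^ n → ‖ψ w‖ ≤ (2 + ‖c‖) * ‖w‖ := by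
    intro n
    induction n with
    | zero =>
      intro w hw hRw
      have := (hR w (by simpa using hRw)).2
      nlinarith [norm_nonneg c]
    | succ n ih =>
      intro w hw hRw
      have hw2 : 1 < ‖w ^ 2‖ := by rw [norm_pow]; exact one_lt_pow₀ hw two_ne_zero
      have h := ih (w ^ 2) hw2 (by rwa [norm_pow, ← pow_mul, ← pow_succ'])
      have hs : ψ w ^ 2 = ψ (w ^ 2) - c := by rw [hψ.semiconj w hw, quadMap]; ring
      have h2 : ‖ψ w‖ ^ 2 ≤ ‖ψ (w ^ 2)‖ + ‖c‖ := by
        rw [← norm_pow, hs]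
        exact norm_sub_le _ _
      rw [norm_pow] at h
      refine le_of_sq_le_sq ?_ (by positivity)
      have hc := norm_nonneg c
      have hw1 : 1 ≤ ‖w‖ ^ 2 := one_le_pow₀ hw.le
      nlinarith [mul_nonneg hc (sub_nonneg.2 hw1), mul_nonneg hc (sq_nonneg ‖w‖),
        mul_nonneg (sq_nonneg ‖c‖) (sq_nonneg ‖w‖)]
  obtain ⟨n, hn⟩ := pow_unbounded_of_one_lt R hw
  exact key n w hw (hn.le.trans (pow_le_pow_right₀ hw.le Nat.lt_two_pow_self.le))

theorem not_eventually_const (hψ : IsInverseBottcher c ψ) {w : ℂ} (hw : 1 < ‖w‖) :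
    ¬ ∀ᶠ z in 𝓝 w, ψ z = ψ w := by
  intro h
  have h1 : ∀ᶠ z in 𝓝 w, z = w := by
    filter_upwards [h, isOpen_one_lt_norm.mem_nhds hw] with z hz hz1
    exact hψ.bijOn.injOn hz1 hw hz
  have h2 : ∀ᶠ z in 𝓝[≠] w, z = w := h1.filter_mono nhdsWithin_le_nhds
  obtain ⟨z, hz, hne⟩ := (h2.and self_mem_nhdsWithin).exists
  exact hne hz

theorem image_mem_nhds (hψ : IsInverseBottcher c ψ) {w : ℂ} (hw : 1 < ‖w‖) {U : Set ℂ}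
    (hU : U ∈ 𝓝 w) : ψ '' U ∈ 𝓝 (ψ w) :=
  (hψ.analyticAt hw).eventually_constant_or_nhds_le_map_nhds.resolve_left
    (hψ.not_eventually_const hw) (image_mem_map hU)

theorem isClosed_filledJulia (hψ : IsInverseBottcher c ψ) : IsClosed (filledJulia c) := by
  rw [← isOpen_compl_iff, ← hψ.bijOn.image_eq, isOpen_iff_mem_nhds]
  rintro _ ⟨w, hw, rfl⟩
  exact hψ.image_mem_nhds hw (isOpen_one_lt_norm.mem_nhds hw)

/-- Every open set meeting the exterior of the unit disk contains a noncritical point. -/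
theorem exists_deriv_ne_zero (hψ : IsInverseBottcher c ψ) {w : ℂ} (hw : 1 < ‖w‖) {U : Set ℂ}
    (hU : U ∈ 𝓝 w) : ∃ z ∈ U, 1 < ‖z‖ ∧ deriv ψ z ≠ 0 := by
  obtain ⟨ε, hε, hball⟩ := Metric.mem_nhds_iff.1 (inter_mem hU (isOpen_one_lt_norm.mem_nhds hw))
  by_contra! h
  refine hψ.not_eventually_const hw ?_
  filter_upwards [ball_mem_nhds w hε] with z hz
  refine isOpen_ball.is_const_of_deriv_eq_zero (convex_ball w ε).isPreconnected
    (hψ.differentiableOn.mono fun z hz => (hball hz).2) (fun x hx => ?_) hz (mem_ball_self hε)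
  exact h x (hball hx).1 (hball hx).2

/-- Points not attained by `ψ` away from the unit circle stay at positive distance from its
values there. -/
theorem exists_pos_le_norm_sub (hψ : IsInverseBottcher c ψ) {z : ℂ} {s : ℝ} (hs : 1 < s)
    (hz : ∀ w : ℂ, s ≤ ‖w‖ → ψ w ≠ z) : ∃ ε > 0, ∀ w : ℂ, s ≤ ‖w‖ → ε ≤ ‖ψ w - z‖ := by
  obtain ⟨R, hR⟩ := hψ.exists_norm_bounds
  -- Beyond `R'` one has `‖ψ w‖ ≥ ‖z‖ + 1`, so only a compact annulus remains.
  set R' := max R (2 * (‖z‖ + 1))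
  let S : Set ℂ := {w : ℂ | s ≤ ‖w‖} ∩ closedBall 0 R'
  have hS : IsCompact S :=
    (isCompact_closedBall _ _).inter_left (isClosed_le continuous_const continuous_norm)
  have hc : IsClosed (ψ '' S) :=
    (hS.image_of_continuousOn (hψ.differentiableOn.continuousOn.mono
      fun w hw => hs.trans_le hw.1)).isClosed
  have hzS : z ∉ ψ '' S := fun ⟨w, hw, h⟩ => hz w hw.1 h
  obtain ⟨ε, hε, hball⟩ := Metric.mem_nhds_iff.1 (hc.isOpen_compl.mem_nhds hzS)
  refine ⟨min ε 1, by positivity, fun w hw => ?_⟩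
  by_cases hwR : ‖w‖ ≤ R'
  · refine (min_le_left _ _).trans ?_
    by_contra! h
    exact hball (mem_ball_iff_norm.2 h) ⟨w, ⟨hw, by simpa using hwR⟩, rfl⟩
  · refine (min_le_right _ _).trans ?_
    push Not at hwR
    have h1 := (hR w ((le_max_left _ _).trans hwR.le)).1
    have h2 : 2 * (‖z‖ + 1) < ‖w‖ := (le_max_right _ _).trans_lt hwR
    have h3 := norm_sub_norm_le (ψ w) z
    linarith

/-- Radial limits exist almost everywhere. -/
theorem ae_tendsto_radialLimit (hψ : IsInverseBottcher c ψ) :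
    ∀ᵐ t : UnitAddCircle, Tendsto (fun r : ℝ => ψ ((r : ℂ) * (AddCircle.toCircle t : ℂ)))
      (𝓝[>] 1) (𝓝 (radialLimit ψ t)) := by
  have hb : Bornology.IsBounded (ψ '' {w : ℂ | 1 < ‖w‖ ∧ ‖w‖ < Real.exp (2 * Real.pi)}) := by
    refine (isBounded_iff_forall_norm_le).2 ⟨(2 + ‖c‖) * Real.exp (2 * Real.pi), ?_⟩
    rintro _ ⟨w, hw, rfl⟩
    refine (hψ.norm_le hw.1).trans ?_
    gcongr
    exact hw.2.le
  filter_upwards [ae_exists_radial_limit hψ.differentiableOn hψ.bijOn.injOn hb] with t ht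
  exact tendsto_nhds_limUnder ht

end IsInverseBottcher

/-! ### Blaschke factors and removable singularities -/

theorem norm_one_sub_conj_mul_ge {a u : ℂ} (hu : ‖u‖ ≤ 1) :
    1 - ‖a‖ ≤ ‖1 - conj a * u‖ := by
  have h := norm_sub_norm_le 1 (conj a * u)
  rw [norm_one, norm_mul, Complex.norm_conj] at h
  nlinarith [norm_nonneg a]

theorem norm_sub_le_norm_one_sub_conj_mul {a : ℂ} (ha : ‖a‖ < 1) {u : ℂ} (hu : ‖u‖ ≤ 1) :
    ‖u - a‖ ≤ ‖1 - conj a * u‖ := by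
  refine le_of_sq_le_sq ?_ (norm_nonneg _)
  have h : ‖1 - conj a * u‖ ^ 2 - ‖u - a‖ ^ 2 = (1 - ‖a‖ ^ 2) * (1 - ‖u‖ ^ 2) := by
    simp only [← Complex.normSq_eq_norm_sq, Complex.normSq_apply, Complex.sub_re, Complex.sub_im,
      Complex.mul_re, Complex.mul_im, Complex.conj_re, Complex.conj_im, Complex.one_re,
      Complex.one_im]
    ring
  have h1 : 0 ≤ (1 - ‖a‖ ^ 2) * (1 - ‖u‖ ^ 2) :=
    mul_nonneg (by nlinarith [norm_nonneg a]) (by nlinarith [norm_nonneg u])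
  linarith

/-- For fixed `u` the Blaschke factor with zero `a` tends to modulus 1 as `‖a‖ → 1`; this is a
quantitative version. -/
theorem half_norm_one_sub_conj_mul_le {a u : ℂ} (ha : ‖a‖ < 1)
    (hau : 1 - (1 - ‖u‖) / 4 ≤ ‖a‖) : ‖1 - conj a * u‖ / 2 ≤ ‖u - a‖ := by
  have h1 : 1 - conj a * u = (1 - ‖a‖ ^ 2 : ℝ) + conj a * (a - u) := by
    rw [mul_sub, ← Complex.normSq_eq_conj_mul_self, Complex.normSq_eq_norm_sq]
    push_cast
    ring
  have h2 : ‖1 - conj a * u‖ ≤ (1 - ‖a‖ ^ 2) + ‖u - a‖ := by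
    conv_lhs => rw [h1]
    refine (norm_add_le _ _).trans (add_le_add ?_ ?_)
    · rw [Complex.norm_of_nonneg (by nlinarith [norm_nonneg a])]
    · rw [norm_mul, Complex.norm_conj, norm_sub_rev]
      nlinarith [norm_nonneg (u - a)]
  have h3 : 1 - ‖u‖ ≤ ‖1 - conj a * u‖ := by
    have h := norm_sub_norm_le 1 (conj a * u)
    rw [norm_one, norm_mul, Complex.norm_conj] at h
    nlinarith [norm_nonneg u]
  nlinarith [norm_nonneg a]

/-- Riemann's removable singularity theorem; the bound passes to `p` by continuity. -/
theorem exists_bounded_extension {s : Set ℂ} (hs : IsOpen s) {p : ℂ} (hp : p ∈ s) {H : ℂ → ℂ}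
    {C : ℝ} (hd : DifferentiableOn ℂ H (s \ {p})) (hC : ∀ z ∈ s \ {p}, ‖H z‖ ≤ C) :
    ∃ G : ℂ → ℂ, DifferentiableOn ℂ G s ∧ (∀ z, z ≠ p → G z = H z) ∧ ∀ z ∈ s, ‖G z‖ ≤ C := by
  have hG := Complex.differentiableOn_update_limUnder_of_bddAbove (hs.mem_nhds hp) hd
    ⟨C, by rintro _ ⟨z, hz, rfl⟩; exact hC z hz⟩
  set G := Function.update H p (limUnder (𝓝[≠] p) H)
  have hGH : ∀ z, z ≠ p → G z = H z := fun z hz => Function.update_of_ne hz _ _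
  refine ⟨G, hG, hGH, fun z hz => ?_⟩
  by_cases hzp : z = p
  · subst hzp
    have h1 : Tendsto (fun w => ‖G w‖) (𝓝[≠] z) (𝓝 ‖G z‖) :=
      ((hG.continuousOn.continuousAt (hs.mem_nhds hz)).norm.tendsto).mono_left nhdsWithin_le_nhds
    refine le_of_tendsto h1 ?_
    filter_upwards [self_mem_nhdsWithin, nhdsWithin_le_nhds (hs.mem_nhds hz)] with w hw hws
    rw [hGH w hw]
    exact hC w ⟨hws, hw⟩
  · rw [hGH z hzp]
    exact hC z ⟨hz, hzp⟩

/-- `norm_le_of_ae_radial_norm_le` for functions with two removable singularities. -/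
theorem norm_le_of_ae_radial_norm_le_of_removable {H : ℂ → ℂ} {C M : ℝ} {u p q : ℂ}
    (hp : ‖p‖ < 1) (hq : ‖q‖ < 1) (hpq : p ≠ q)
    (hd : DifferentiableOn ℂ H ((ball 0 1 \ {q}) \ {p}))
    (hC : ∀ z ∈ (ball (0 : ℂ) 1 \ {q}) \ {p}, ‖H z‖ ≤ C)
    (hM : ∀ᵐ t : UnitAddCircle, ∃ a : ℂ, ‖a‖ ≤ M ∧
      Tendsto (fun r : ℝ => H ((r : ℂ) * (AddCircle.toCircle t : ℂ))) (𝓝[<] 1) (𝓝 a))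
    (hu : ‖u‖ < 1) (hup : u ≠ p) (huq : u ≠ q) : ‖H u‖ ≤ M := by
  obtain ⟨G₁, hG₁d, hG₁, hG₁C⟩ := exists_bounded_extension
    (isOpen_ball.sdiff (isClosed_singleton (x := q))) ⟨mem_ball_zero_iff.2 hp, hpq⟩ hd hC
  obtain ⟨G, hGd, hG, hGC⟩ := exists_bounded_extension isOpen_ball (mem_ball_zero_iff.2 hq)
    hG₁d hG₁C
  rw [← hG₁ u hup, ← hG u huq]
  refine norm_le_of_ae_radial_norm_le hGd hGC ?_ hu
  filter_upwards [hM] with t ⟨a, ha, hta⟩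
  refine ⟨a, ha, hta.congr' ?_⟩
  filter_upwards [Ioo_mem_nhdsLT (max_lt hp hq)] with r hr
  have hr0 : 0 < r := ((norm_nonneg p).trans (le_max_left _ _)).trans_lt hr.1
  have hnorm : ‖(r : ℂ) * (AddCircle.toCircle t : ℂ)‖ = r := by
    rw [norm_mul, Circle.norm_coe, mul_one, Complex.norm_of_nonneg hr0.le]
  rw [hG, hG₁]
  · intro h
    rw [h] at hnorm
    exact (le_max_left _ _).not_gt (hnorm ▸ hr.1)
  · intro h
    rw [h] at hnorm
    exact (le_max_right _ _).not_gt (hnorm ▸ hr.1)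

/-! ### The Julia set lies in the support of the measure -/

namespace IsInverseBottcher

variable {c : ℂ} {ψ : ℂ → ℂ}

/-- At a noncritical point `w₀`, dividing a Blaschke factor vanishing at `w₀⁻¹` by `ψ - ψ w₀`
gives a bounded function. -/
theorem exists_norm_blaschke_div_le (hψ : IsInverseBottcher c ψ) {w₀ : ℂ} (hw₀ : 1 < ‖w₀‖)
    (hd : deriv ψ w₀ ≠ 0) : ∃ C : ℝ, ∀ u : ℂ, ‖u‖ < 1 → u ≠ 0 → u ≠ w₀⁻¹ →
      ‖(u - w₀⁻¹) / (1 - conj w₀⁻¹ * u) / (ψ u⁻¹ - ψ w₀)‖ ≤ C := by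
  have hw0 : w₀ ≠ 0 := norm_pos_iff.1 (zero_lt_one.trans hw₀)
  set a := w₀⁻¹ with ha
  have ha1 : ‖a‖ < 1 := by rw [ha, norm_inv]; exact inv_lt_one_of_one_lt₀ hw₀
  have ha0 : a ≠ 0 := inv_ne_zero hw0
  have hderiv : HasDerivAt (fun u => ψ u⁻¹) (deriv ψ w₀ * -(a ^ 2)⁻¹) a := by
    have h1 : HasDerivAt ψ (deriv ψ w₀) a⁻¹ := by
      rw [ha, inv_inv]; exact (hψ.analyticAt hw₀).differentiableAt.hasDerivAt
    exact h1.comp a (hasDerivAt_inv ha0)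
  set D := deriv ψ w₀ * -(a ^ 2)⁻¹
  have hD : 0 < ‖D‖ := norm_pos_iff.2 (mul_ne_zero hd (by simp [ha0]))
  have hslope := hderiv.tendsto_slope.norm.eventually (lt_mem_nhds (half_lt_self hD))
  obtain ⟨N, hN, hNslope⟩ : ∃ N ∈ 𝓝 a, ∀ u ∈ N, u ≠ a →
      ‖D‖ / 2 * ‖u - a‖ ≤ ‖ψ u⁻¹ - ψ w₀‖ := by
    rw [eventually_nhdsWithin_iff] at hslope
    refine ⟨_, hslope, fun u hu hne => ?_⟩
    have h1 := hu hne
    rw [slope_def_field, norm_div, lt_div_iff₀ (norm_pos_iff.2 (sub_ne_zero.2 hne))] at h1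
    rw [ha, inv_inv] at h1
    exact h1.le
  have hN' : (fun w : ℂ => w⁻¹) ⁻¹' N ∈ 𝓝 w₀ := (continuousAt_inv₀ hw0).preimage_mem_nhds hN
  obtain ⟨ε, hε, hball⟩ := Metric.mem_nhds_iff.1
    (hψ.image_mem_nhds hw₀ (inter_mem hN' (isOpen_one_lt_norm.mem_nhds hw₀)))
  refine ⟨max ((‖D‖ / 2)⁻¹ * (1 - ‖a‖)⁻¹) ε⁻¹, fun u hu hu0 hua => ?_⟩
  have hpos : 0 < ‖1 - conj a * u‖ :=
    (by linarith : 0 < 1 - ‖a‖).trans_le (norm_one_sub_conj_mul_ge hu.le)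
  rw [norm_div, norm_div]
  -- Near `a` the zero of the Blaschke factor cancels the simple zero of the denominator. Elsewhere
  -- injectivity and openness of `ψ` keep the denominator at least `ε`.
  by_cases huN : u ∈ N
  · refine le_trans ?_ (le_max_left _ _)
    have h1 := hNslope u huN hua
    have h2 : 0 < ‖u - a‖ := norm_pos_iff.2 (sub_ne_zero.2 hua)
    calc ‖u - a‖ / ‖1 - conj a * u‖ / ‖ψ u⁻¹ - ψ w₀‖
        ≤ ‖u - a‖ / (1 - ‖a‖) / (‖D‖ / 2 * ‖u - a‖) := by
          have := norm_one_sub_conj_mul_ge (a := a) hu.le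
          have h3 : 0 < 1 - ‖a‖ := by linarith
          gcongr
      _ = _ := by
          field_simp
  · refine le_trans ?_ (le_max_right _ _)
    have h1 : ε ≤ ‖ψ u⁻¹ - ψ w₀‖ := by
      by_contra! h
      obtain ⟨w, ⟨hwN, hw⟩, hwu⟩ := hball (mem_ball_iff_norm.2 h)
      have hu1 : 1 < ‖u⁻¹‖ := by
        rw [norm_inv]; exact (one_lt_inv₀ (norm_pos_iff.2 hu0)).2 hu
      rw [hψ.bijOn.injOn hw hu1 hwu] at hwN
      exact huN (by simpa using hwN)
    rw [← one_div ε]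
    refine div_le_div₀ zero_le_one ?_ hε h1
    exact div_le_one_of_le₀ (norm_sub_le_norm_one_sub_conj_mul ha1 hu.le) hpos.le

/-- The radial limits come arbitrarily close to every point of the Julia set on a set of positive
measure. -/
theorem not_ae_le_norm_radialLimit_sub (hψ : IsInverseBottcher c ψ) {z₀ : ℂ} (hz₀ : z₀ ∈ julia c)
    {δ : ℝ} (hδ : 0 < δ) : ¬ ∀ᵐ t : UnitAddCircle, δ ≤ ‖radialLimit ψ t - z₀‖ := by
  intro hfar
  have hz₀K : z₀ ∈ filledJulia c := hψ.isClosed_filledJulia.frontier_subset hz₀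
  have hclos : z₀ ∈ closure (ψ '' {w : ℂ | 1 < ‖w‖}) := by
    rw [hψ.bijOn.image_eq]
    rw [julia, frontier_eq_closure_inter_closure] at hz₀
    exact hz₀.2
  have hnear : ∀ η > 0, ∃ w : ℂ, 1 < ‖w‖ ∧ ‖ψ w - z₀‖ < η := fun η hη => by
    obtain ⟨_, ⟨w, hw, rfl⟩, h⟩ := Metric.mem_closure_iff.1 hclos η hη
    exact ⟨w, hw, by rwa [dist_comm, dist_eq_norm] at h⟩
  obtain ⟨w₁, hw₁, hw₁z⟩ := hnear (δ / 8) (by positivity)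
  set u := w₁⁻¹ with hu_def
  have hw₁0 : w₁ ≠ 0 := norm_pos_iff.1 (zero_lt_one.trans hw₁)
  have hu : ‖u‖ < 1 := by rw [hu_def, norm_inv]; exact inv_lt_one_of_one_lt₀ hw₁
  -- The test point `u` is fixed first. Then `w₀` is taken so close to the unit circle that the
  -- Blaschke factor at `u` has modulus at least `1/2`: points with `‖w‖ ≥ κ⁻¹` have values at
  -- distance at least `ε` from `z₀`.
  set κ := 1 - (1 - ‖u‖) / 4 with hκ
  have hκ0 : 0 < κ := by linarith [norm_nonneg u]
  have hκ1 : κ < 1 := by linarith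
  obtain ⟨ε, hε, hεz⟩ := hψ.exists_pos_le_norm_sub (z := z₀) ((one_lt_inv₀ hκ0).2 hκ1)
    fun w hw h => (h ▸ hψ.bijOn.mapsTo (((one_lt_inv₀ hκ0).2 hκ1).trans_le hw)) hz₀K
  obtain ⟨w', hw', hw'z⟩ := hnear (min (δ / 8) ε) (by positivity)
  have hU : ∀ᶠ w in 𝓝 w', ‖ψ w - z₀‖ < min (δ / 8) ε :=
    (((hψ.analyticAt hw').continuousAt.sub_const z₀).norm).eventually_lt_const hw'z
  obtain ⟨w₀, hw₀z, hw₀, hd⟩ := hψ.exists_deriv_ne_zero hw' hU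
  have hw₀0 : w₀ ≠ 0 := norm_pos_iff.1 (zero_lt_one.trans hw₀)
  have hw₀κ : κ ≤ ‖w₀⁻¹‖ := by
    by_contra! h
    rw [norm_inv] at h
    have h1 := hεz w₀ ((inv_lt_comm₀ hκ0 (zero_lt_one.trans hw₀)).2 h).le
    exact (hw₀z.trans_le (min_le_right _ _)).not_ge h1
  obtain ⟨C, hC⟩ := hψ.exists_norm_blaschke_div_le hw₀ hd
  set a := w₀⁻¹ with ha
  set z := ψ w₀ with hz
  have hzz₀ : ‖z - z₀‖ < δ / 8 := lt_of_lt_of_le hw₀z (min_le_left _ _)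
  have ha0 : a ≠ 0 := inv_ne_zero hw₀0
  have ha1 : ‖a‖ < 1 := by rw [ha, norm_inv]; exact inv_lt_one_of_one_lt₀ hw₀
  have hBpos : ∀ v : ℂ, ‖v‖ ≤ 1 → 0 < ‖1 - conj a * v‖ := fun v hv =>
    (by linarith : 0 < 1 - ‖a‖).trans_le (norm_one_sub_conj_mul_ge hv)
  have hhalf := half_norm_one_sub_conj_mul_le ha1 hw₀κ
  have hua : u ≠ a := by
    intro h
    rw [h, sub_self, norm_zero] at hhalf
    linarith [hBpos a ha1.le]
  have hext : ∀ v : ℂ, ‖v‖ < 1 → v ≠ 0 → 1 < ‖v⁻¹‖ := fun v hv hv0 => by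
    rw [norm_inv]; exact (one_lt_inv₀ (norm_pos_iff.2 hv0)).2 hv
  have hne : ∀ v : ℂ, ‖v‖ < 1 → v ≠ 0 → v ≠ a → ψ v⁻¹ - z ≠ 0 := fun v hv hv0 hva h => by
    have := hψ.bijOn.injOn (hext v hv hv0) hw₀ (sub_eq_zero.1 h)
    exact hva (by rw [ha, ← this, inv_inv])
  have hmain := norm_le_of_ae_radial_norm_le_of_removable
    (H := fun v => (v - a) / (1 - conj a * v) / (ψ v⁻¹ - z)) (C := C) (M := 2 / δ) (u := u)
    (p := 0) (q := a) (by simp) ha1 ha0.symm ?_ ?_ ?_ hu (inv_ne_zero hw₁0) hua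
  -- Numerator at least `1/2` and denominator below `δ/4` make the quotient exceed `2/δ`.
  · have hlow : 1 / 2 ≤ ‖u - a‖ / ‖1 - conj a * u‖ := by
      rw [le_div_iff₀ (hBpos u hu.le)]; linarith
    have hclose : ‖ψ u⁻¹ - z‖ < δ / 4 := by
      rw [hu_def, inv_inv, show ψ w₁ - z = (ψ w₁ - z₀) - (z - z₀) by ring]
      exact (norm_sub_le _ _).trans_lt (by linarith)
    have hpos : 0 < ‖ψ u⁻¹ - z‖ := norm_pos_iff.2 (hne u hu (inv_ne_zero hw₁0) hua)
    rw [norm_div, norm_div, div_le_div_iff₀ hpos hδ] at hmain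
    nlinarith
  · rintro v ⟨⟨hv, hva⟩, hv0⟩
    rw [mem_ball_zero_iff] at hv
    have h1 : DifferentiableAt ℂ (fun v => ψ v⁻¹) v :=
      DifferentiableAt.comp v (hψ.analyticAt (hext v hv hv0)).differentiableAt
        (differentiableAt_inv hv0)
    refine DifferentiableAt.differentiableWithinAt ?_
    refine DifferentiableAt.div (DifferentiableAt.div (by fun_prop) (by fun_prop) ?_)
      (h1.sub_const z) (hne v hv hv0 hva)
    exact norm_pos_iff.1 (hBpos v hv.le)
  · rintro v ⟨⟨hv, hva⟩, hv0⟩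
    exact hC v (mem_ball_zero_iff.1 hv) hv0 hva
  -- The inversion `v ↦ v⁻¹` reverses angles, so the boundary value at `t` involves the radial limit
  -- at `-t`.
  · have hneg := (Measure.measurePreserving_neg
      (volume : Measure UnitAddCircle)).quasiMeasurePreserving.ae
      (hψ.ae_tendsto_radialLimit.and hfar)
    filter_upwards [hneg] with t ⟨ht, htfar⟩
    set L := radialLimit ψ (-t)
    have hLz : δ / 2 ≤ ‖L - z‖ := by
      have := norm_sub_norm_le (L - z₀) (z - z₀)
      rw [sub_sub_sub_cancel_right] at this
      linarith
    set τ : ℂ := (AddCircle.toCircle t : ℂ) with hτ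
    have hτ1 : ‖τ‖ = 1 := Circle.norm_coe _
    refine ⟨(τ - a) / (1 - conj a * τ) / (L - z), ?_, ?_⟩
    · rw [norm_div, norm_div, show 2 / δ = 1 / (δ / 2) by field_simp]
      refine div_le_div₀ zero_le_one ?_ (by positivity) hLz
      exact div_le_one_of_le₀ (norm_sub_le_norm_one_sub_conj_mul ha1 hτ1.le) (norm_nonneg _)
    · have hr : Tendsto (fun r : ℝ => (r : ℂ) * τ) (𝓝[<] 1) (𝓝 τ) := by
        have : Continuous fun r : ℝ => (r : ℂ) * τ := by fun_prop
        simpa using (this.tendsto 1).mono_left nhdsWithin_le_nhds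
      have hinv : Tendsto (fun r : ℝ => r⁻¹) (𝓝[<] 1) (𝓝[>] 1) := by
        refine tendsto_nhdsWithin_iff.2 ⟨?_, ?_⟩
        · have := (continuousAt_inv₀ (one_ne_zero (α := ℝ))).tendsto
          rw [inv_one] at this
          exact this.mono_left nhdsWithin_le_nhds
        · filter_upwards [Ioo_mem_nhdsLT (zero_lt_one (α := ℝ))] with r hr
          exact (one_lt_inv₀ hr.1).2 hr.2
      have hψL : Tendsto (fun r : ℝ => ψ ((r : ℂ) * τ)⁻¹) (𝓝[<] 1) (𝓝 L) := by
        refine (ht.comp hinv).congr fun r => ?_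
        simp [AddCircle.toCircle_neg, hτ, mul_comm]
      refine ((hr.sub_const a).div ((hr.const_mul _).const_sub 1) ?_).div (hψL.sub_const z) ?_
      · exact norm_pos_iff.1 (hBpos τ hτ1.le)
      · exact norm_pos_iff.1 (by linarith)

end IsInverseBottcher

/-! ### Zero-one law and conclusion -/

/-- A zero-one law for the outer measure of forward invariant sets under a factor of an ergodic
map. -/
theorem map_measure_eq_zero_or_one_of_image_subset {X Y : Type*} [MeasurableSpace X]
    [MeasurableSpace Y] {ν : Measure X} [IsProbabilityMeasure ν] {T : X → X} (hT : Ergodic T ν)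
    {f : Y → Y} (hf : Measurable f) {γ : X → Y} (hγ : AEMeasurable γ ν)
    (hsemi : ∀ᵐ x ∂ν, γ (T x) = f (γ x)) {A : Set Y} (hA : f '' A ⊆ A) :
    ν.map γ A = 0 ∨ ν.map γ A = 1 := by
  set μ := ν.map γ
  have : IsProbabilityMeasure μ := Measure.isProbabilityMeasure_map hγ
  -- The hull carries the outer measure of `A`, which need not be measurable.
  set B := toMeasurable μ A
  have hB : MeasurableSet B := measurableSet_toMeasurable μ A
  have hμB : μ B = μ A := measure_toMeasurable A
  have hAB : A ⊆ B ∩ f ⁻¹' B := fun x hx =>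
    ⟨subset_toMeasurable μ A hx, subset_toMeasurable μ A (hA ⟨x, hx, rfl⟩)⟩
  have hle : B ≤ᵐ[μ] f ⁻¹' B := by
    have h1 : (B ∩ f ⁻¹' B : Set Y) =ᵐ[μ] B :=
      ae_eq_of_subset_of_measure_ge Set.inter_subset_left (hμB.le.trans (measure_mono hAB))
        (hB.inter (hf hB)).nullMeasurableSet (measure_ne_top _ _)
    exact h1.symm.le.trans (Eventually.of_forall fun x hx => hx.2)
  have hS : (γ ⁻¹' B : Set X) ≤ᵐ[ν] T ⁻¹' (γ ⁻¹' B) := by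
    filter_upwards [ae_of_ae_map hγ hle, hsemi] with x hx hsx hxB
    change γ (T x) ∈ B
    rw [hsx]
    exact hx hxB
  rw [← hμB, Measure.map_apply_of_aemeasurable hγ hB]
  refine (hT.ae_empty_or_univ_of_ae_le_preimage (hγ.nullMeasurableSet_preimage hB) hS).imp
    (fun h => ?_) fun h => ?_
  · rw [measure_congr h, measure_empty]
  · rw [measure_congr h, measure_univ]

theorem continuous_quadMap (c : ℂ) : Continuous (quadMap c) :=
  (continuous_pow 2).add continuous_const

namespace IsInverseBottcher

variable {c : ℂ} {ψ : ℂ → ℂ}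

theorem aemeasurable_radialLimit (hψ : IsInverseBottcher c ψ) :
    AEMeasurable (radialLimit ψ) (volume : Measure UnitAddCircle) := by
  obtain ⟨r, -, hr1, hr⟩ := exists_seq_strictAnti_tendsto (1 : ℝ)
  have hr' : Tendsto r atTop (𝓝[>] 1) :=
    tendsto_nhdsWithin_iff.2 ⟨hr, Eventually.of_forall hr1⟩
  refine aemeasurable_of_tendsto_metrizable_ae atTop
    (f := fun n t => ψ ((r n : ℂ) * (AddCircle.toCircle t : ℂ))) (fun n => ?_) ?_
  · refine Continuous.aemeasurable (hψ.differentiableOn.continuousOn.comp_continuous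
      (continuous_const.mul (continuous_subtype_val.comp AddCircle.continuous_toCircle))
      fun t => ?_)
    change 1 < ‖(r n : ℂ) * (AddCircle.toCircle t : ℂ)‖
    rw [norm_mul, Circle.norm_coe, mul_one,
      Complex.norm_of_nonneg (zero_le_one.trans (hr1 n).le)]
    exact hr1 n
  · filter_upwards [hψ.ae_tendsto_radialLimit] with t ht
    exact ht.comp hr'

/-- The radial limits conjugate angle doubling to the quadratic polynomial. -/
theorem ae_radialLimit_two_nsmul (hψ : IsInverseBottcher c ψ) :
    ∀ᵐ t : UnitAddCircle, radialLimit ψ (2 • t) = quadMap c (radialLimit ψ t) := by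
  have hdouble := (AddCircle.ergodic_nsmul (T := (1 : ℝ))
    one_lt_two).quasiMeasurePreserving.ae hψ.ae_tendsto_radialLimit
  filter_upwards [hψ.ae_tendsto_radialLimit, hdouble] with t ht h2t
  -- Squaring sends radius `r` at angle `t` to radius `r ^ 2` at angle `2t`, so the limit at `2t` is
  -- taken along `r ^ 2`.
  have hsq : Tendsto (fun r : ℝ => r ^ 2) (𝓝[>] 1) (𝓝[>] 1) := by
    refine tendsto_nhdsWithin_iff.2 ⟨?_, ?_⟩
    · have := ((continuous_pow (M := ℝ) 2).tendsto 1).mono_left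
        (nhdsWithin_le_nhds (s := Set.Ioi 1))
      rwa [one_pow] at this
    · filter_upwards [self_mem_nhdsWithin] with r hr
      exact one_lt_pow₀ (Set.mem_Ioi.1 hr) two_ne_zero
  refine tendsto_nhds_unique (h2t.comp hsq)
    ((((continuous_quadMap c).tendsto _).comp ht).congr' ?_)
  filter_upwards [self_mem_nhdsWithin] with r hr
  have hr1 : (1 : ℝ) < r := hr
  simp only [Function.comp_apply]
  rw [← hψ.semiconj _ (by rwa [norm_mul, Circle.norm_coe, mul_one,
    Complex.norm_of_nonneg (zero_le_one.trans hr1.le)]), AddCircle.toCircle_nsmul]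
  push_cast
  rw [mul_pow]

theorem map_radialLimit_eq_zero_or_one (hψ : IsInverseBottcher c ψ) {A : Set ℂ}
    (hA : quadMap c '' A ⊆ A) :
    (volume : Measure UnitAddCircle).map (radialLimit ψ) A = 0 ∨
      (volume : Measure UnitAddCircle).map (radialLimit ψ) A = 1 := by
  have : IsProbabilityMeasure (volume : Measure UnitAddCircle) := ⟨UnitAddCircle.measure_univ⟩
  exact map_measure_eq_zero_or_one_of_image_subset (AddCircle.ergodic_nsmul one_lt_two)
    (continuous_quadMap c).measurable hψ.aemeasurable_radialLimit hψ.ae_radialLimit_two_nsmul hA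

/-- A closed set of full measure contains the Julia set. -/
theorem julia_subset_of_map_radialLimit_eq_one (hψ : IsInverseBottcher c ψ) {A : Set ℂ}
    (hA : IsClosed A) (h : (volume : Measure UnitAddCircle).map (radialLimit ψ) A = 1) :
    julia c ⊆ A := by
  intro z hz
  by_contra hzA
  have : IsProbabilityMeasure (volume : Measure UnitAddCircle) := ⟨UnitAddCircle.measure_univ⟩
  have := Measure.isProbabilityMeasure_map hψ.aemeasurable_radialLimit
  obtain ⟨δ, hδ, hball⟩ := Metric.isOpen_iff.1 hA.isOpen_compl z hzA
  refine hψ.not_ae_le_norm_radialLimit_sub hz hδ ?_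
  have hae : ∀ᵐ x ∂(volume : Measure UnitAddCircle).map (radialLimit ψ), x ∈ A :=
    (prob_compl_eq_zero_iff hA.measurableSet).2 h
  filter_upwards [ae_of_ae_map hψ.aemeasurable_radialLimit hae] with t ht
  by_contra! hlt
  exact hball (mem_ball_iff_norm.2 hlt) ht

end IsInverseBottcher

end QuadraticDynamics

theorem mainTheorem6 (c : ℂ)
    (hconn : IsConnected (QuadraticDynamics.filledJulia c))
    (hloc : LocallyConnectedSpace (QuadraticDynamics.filledJulia c))
    (A : Set ℂ) (hAJ : A ⊆ QuadraticDynamics.julia c)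
    (hinv : QuadraticDynamics.quadMap c '' A ⊆ A) :
    (QuadraticDynamics.brolinMeasure c A = 0 ∨ QuadraticDynamics.brolinMeasure c A = 1) ∧
      (IsCompact A → A ≠ QuadraticDynamics.julia c →
        QuadraticDynamics.brolinMeasure c A = 0) := by
  by_cases h : ∃ ψ : ℂ → ℂ, QuadraticDynamics.IsInverseBottcher c ψ
  · have hψ := h.choose_spec
    rw [QuadraticDynamics.brolinMeasure, dif_pos h]
    have h01 := hψ.map_radialLimit_eq_zero_or_one hinv
    refine ⟨h01, fun hA hne => h01.resolve_right fun h1 => hne ?_⟩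
    exact hAJ.antisymm (hψ.julia_subset_of_map_radialLimit_eq_one hA.isClosed h1)
  -- In the default branch the measure is zero.
  · simp [QuadraticDynamics.brolinMeasure, dif_neg h]
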